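/- There exist non-decreasing functions $f_1,f_2,f_3,f_4\colon(0,1]\to(0,1]$ such that the following holds for all $\alpha,\mu,\varepsilon,c\in(0,1]$ and all integers $n\ge 1$ with $\mu\le f_1(\alpha)$, $\varepsilon\le f_2(\mu)$, $c\le f_3(\varepsilon)$ and $1/n\le f_4(c)$ (that is, for $1/n\ll c\ll\varepsilon\ll\mu\ll\alpha$). Let $D$ be an $n$-vertex digraph in which every vertex has in-degree and out-degree at least $(1/2+\alpha)n$. Let $T$ be an oriented tree (a digraph obtained from an undirected tree by giving each edge one direction) with $\lfloor\mu n\rfloor$ vertices in which every in-degree and every out-degree is at most $cn/\log n$, and let $t\in V(T)$. Then there are a set $A\subseteq V(D)$ with $|A|=\lfloor(\mu-\varepsilon)n\rfloor$ and a vertex $v\in A$ such that, for every set $B$ with $A\subseteq B\subseteq V(D)$ and $|B|=\lfloor\mu n\rfloor$, the induced subdigraph $D[B]$ contains a copy of $T$ in which $t$ is copied to $v$. -/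

import Mathlib

/-- A threshold function of the hierarchy notation `a ≪ b`: a non-decreasing function
from `(0, 1]` to `(0, 1]` (values outside `(0, 1]` are irrelevant). -/
structure IsHierarchyFun (f : ℝ → ℝ) : Prop where
  mapsTo : Set.MapsTo f (Set.Ioc 0 1) (Set.Ioc 0 1)
  monotoneOn : MonotoneOn f (Set.Ioc 0 1)

namespace Digraph

variable {V W : Type*}

/-- `d⁺(v)`, the number of out-neighbours of `v`. -/
noncomputable def outDegree (D : Digraph V) (v : V) : ℕ := {w | D.Adj v w}.ncard

/-- `d⁻(v)`, the number of in-neighbours of `v`. -/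
noncomputable def inDegree (D : Digraph V) (v : V) : ℕ := {w | D.Adj w v}.ncard

/-- `δ⁰(D)`, the smallest in- or out-degree over the vertices of `D`. -/
noncomputable def minSemidegree (D : Digraph V) : ℕ := ⨅ v, min (D.outDegree v) (D.inDegree v)

/-- `Δ⁺(D)`, the maximum out-degree of a finite digraph. -/
noncomputable def maxOutDegree [Fintype V] (D : Digraph V) : ℕ := Finset.univ.sup D.outDegree

/-- `Δ⁻(D)`, the maximum in-degree of a finite digraph. -/
noncomputable def maxInDegree [Fintype V] (D : Digraph V) : ℕ := Finset.univ.sup D.inDegree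

/-- `T` is an oriented tree: at most one of `uv` and `vu` is an edge (in particular there
are no loops), and the underlying undirected graph is a tree. -/
structure IsOrientedTree (T : Digraph V) : Prop where
  asymm : ∀ u v, T.Adj u v → ¬ T.Adj v u
  isTree : T.toSimpleGraphInclusive.IsTree

/-- `D[B]`, the digraph induced by `D` on the vertex set `B`. -/
def inducedOn (D : Digraph V) (B : Finset V) : Digraph B where
  Adj x y := D.Adj x y

/-- A copy of `T` in `D` (as a not necessarily induced subgraph): an injection of the vertices
of `T` into those of `D` that preserves the directed edges. -/
structure Copy (T : Digraph W) (D : Digraph V) where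
  toEmbedding : W ↪ V
  map_adj : ∀ a b, T.Adj a b → D.Adj (toEmbedding a) (toEmbedding b)

end Digraph

/-! List the vertices of T from t so that each later one has exactly one earlier neighbour, its
parent. The set A is the image of a suitable embedding of the first N = ⌊(μ - ε)n⌋ vertices, and the
distinguished vertex is the image of t. The remaining vertices are added by switching. A new vertex
must land on a b-neighbour of the image p of its parent, while a free vertex v of B need not be one.
If some s sits on a b-neighbour of p, and v is joined correctly to the images of the parent and the
children of s, then s moves to v and the new vertex takes the vacated place
(`IsPartialCopy.exists_extension`). It suffices that for every triple (b, p, v) the switchable s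
number more than twice the vertices to be added.

Such an embedding is found by a random greedy choice (`exists_isPartialCopy_switchable`). Any two
neighbourhoods share at least 2αn vertices, so each choice falls into a prescribed neighbourhood
with probability at least μ, whatever happened before. A vertex s with at most one child needs at
most three such successes, hence is switchable with probability at least μ³, and linearly many such
s form an independent set (`exists_independent_numChildren_le_one`). The degree bound on T limits
the effect of one choice, so that concentration beats a union bound over the 2n² triples. The
concentration argument is deterministic: an exponential potential summed over all triples is
controlled by conditional expectations (`exists_forall_half_le_card_success`). -/

/-! ### Derandomized sequential choice -/

/-- The conditional probability that the requirements `φ y ∈ Z y`, `y ∈ Q`, are all met, estimated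
after the images of `0, …, x - 1` have been chosen, if each later choice succeeds with
probability `β`. -/
noncomputable def successWeight {V : Type*} (β : ℝ) (Q : Finset ℕ) (Z : ℕ → Set V) (x : ℕ)
    (φ : ℕ → V) : ℝ :=
  open Classical in
  if ∀ y ∈ Q, y < x → φ y ∈ Z y then β ^ (Q.filter (x ≤ ·)).card else 0

section successWeight

variable {V : Type*} {β : ℝ} {Q : Finset ℕ} {Z : ℕ → Set V} {x : ℕ} {φ : ℕ → V}

theorem successWeight_nonneg (hβ : 0 ≤ β) : 0 ≤ successWeight β Q Z x φ := by
  unfold successWeight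
  split_ifs <;> positivity

theorem successWeight_le_one (hβ : 0 ≤ β) (hβ1 : β ≤ 1) : successWeight β Q Z x φ ≤ 1 := by
  unfold successWeight
  split_ifs
  · exact pow_le_one₀ hβ hβ1
  · exact zero_le_one

theorem successWeight_zero : successWeight β Q Z 0 φ = β ^ Q.card := by
  simp [successWeight]

theorem successWeight_of_subset (h : Q ⊆ Finset.range x) [Decidable (∀ y ∈ Q, φ y ∈ Z y)] :
    successWeight β Q Z x φ = if ∀ y ∈ Q, φ y ∈ Z y then 1 else 0 := by
  have h1 : Q.filter (x ≤ ·) = ∅ :=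
    Finset.filter_eq_empty_iff.2 fun y hy => not_le.2 (Finset.mem_range.1 (h hy))
  have h2 : (∀ y ∈ Q, y < x → φ y ∈ Z y) ↔ ∀ y ∈ Q, φ y ∈ Z y :=
    forall₂_congr fun y hy => by simp [Finset.mem_range.1 (h hy)]
  simp only [successWeight, h1, h2, Finset.card_empty, pow_zero]

theorem successWeight_update_of_notMem (hx : x ∉ Q) (u : V) :
    successWeight β Q Z (x + 1) (Function.update φ x u) = successWeight β Q Z x φ := by
  have h1 : Q.filter (x + 1 ≤ ·) = Q.filter (x ≤ ·) :=
    Finset.filter_congr fun y hy => by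
      have : y ≠ x := fun h => hx (h ▸ hy)
      omega
  have h2 : (∀ y ∈ Q, y < x + 1 → Function.update φ x u y ∈ Z y) ↔
      ∀ y ∈ Q, y < x → φ y ∈ Z y :=
    forall₂_congr fun y hy => by
      have : y ≠ x := fun h => hx (h ▸ hy)
      rw [Function.update_of_ne this]
      have : y < x + 1 ↔ y < x := by omega
      rw [this]
  simp only [successWeight, h1]
  classical
  exact if_congr h2 rfl rfl

/-- A pending requirement contributes a factor β, which is refunded when it is met; otherwise the
weight drops to zero. This makes the weight a submartingale once the success probability is at least
β. -/
theorem mul_successWeight_update (hx : x ∈ Q) (u : V) [Decidable (u ∈ Z x)] :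
    β * successWeight β Q Z (x + 1) (Function.update φ x u) =
      if u ∈ Z x then successWeight β Q Z x φ else 0 := by
  have h1 : Q.filter (x ≤ ·) = insert x (Q.filter (x + 1 ≤ ·)) := by
    ext y
    simp only [Finset.mem_filter, Finset.mem_insert]
    constructor
    · rintro ⟨hy, h⟩
      rcases h.eq_or_lt with h | h
      · exact Or.inl h.symm
      · exact Or.inr ⟨hy, h⟩
    · rintro (rfl | ⟨hy, h⟩)
      · exact ⟨hx, le_rfl⟩
      · exact ⟨hy, by omega⟩
  have h2 : (Q.filter (x ≤ ·)).card = (Q.filter (x + 1 ≤ ·)).card + 1 := by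
    rw [h1, Finset.card_insert_of_notMem (by simp)]
  have h3 : (∀ y ∈ Q, y < x + 1 → Function.update φ x u y ∈ Z y) ↔
      u ∈ Z x ∧ ∀ y ∈ Q, y < x → φ y ∈ Z y := by
    constructor
    · intro h
      refine ⟨by simpa using h x hx (Nat.lt_succ_self x), fun y hy hyx => ?_⟩
      simpa [Function.update_of_ne hyx.ne] using h y hy (by omega)
    · rintro ⟨hu, h⟩ y hy hyx
      rcases (Nat.lt_succ_iff.1 hyx).eq_or_lt with rfl | hlt
      · simpa using hu
      · simpa [Function.update_of_ne hlt.ne] using h y hy hlt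
  classical
  unfold successWeight
  by_cases hu : u ∈ Z x
  · by_cases h : ∀ y ∈ Q, y < x → φ y ∈ Z y
    · rw [if_pos (h3.2 ⟨hu, h⟩), if_pos hu, if_pos h, h2, pow_succ']
    · rw [if_neg fun h' => h (h3.1 h').2, if_pos hu, if_neg h, mul_zero]
  · rw [if_neg fun h' => hu (h3.1 h').1, if_neg hu, mul_zero]

/-- The average of the weight over a set of choices that meets `Z x` in proportion at least `β`
does not decrease. -/
theorem card_mul_successWeight_le (hβ : 0 < β) (C : Finset V)
    (hC : x ∈ Q → β * C.card ≤ (({u | u ∈ C ∧ u ∈ Z x} : Set V).ncard : ℝ)) :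
    C.card * successWeight β Q Z x φ ≤
      ∑ u ∈ C, successWeight β Q Z (x + 1) (Function.update φ x u) := by
  classical
  by_cases hx : x ∈ Q
  · refine le_of_mul_le_mul_left ?_ hβ
    rw [Finset.mul_sum]
    simp only [mul_successWeight_update hx]
    rw [← Finset.sum_filter, Finset.sum_const, nsmul_eq_mul, ← mul_assoc]
    have h := hC hx
    have h2 : ({u | u ∈ C ∧ u ∈ Z x} : Set V) = ↑(C.filter (· ∈ Z x)) := by ext; simp
    rw [h2, Set.ncard_coe_finset] at h
    exact mul_le_mul_of_nonneg_right h (successWeight_nonneg hβ.le)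
  · simp [successWeight_update_of_notMem hx]

end successWeight

theorem exp_neg_le_one_sub_add_sq {z : ℝ} (hz : |z| ≤ 1) : Real.exp (-z) ≤ 1 - z + z ^ 2 := by
  have h := (abs_le.1 (Real.abs_exp_sub_one_sub_id_le (x := -z) (by rwa [abs_neg]))).2
  rw [neg_sq] at h
  linarith

/-- One step of the method of conditional expectations for the exponential potential. -/
theorem exists_sum_exp_neg_le {V J : Type*} [Fintype J] (C : Finset V) (hC : C.Nonempty)
    (a : J → ℝ) (b : J → V → ℝ) {r k : ℝ} (hr : 0 ≤ r) (hk : r * k ≤ 1)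
    (hab : ∀ j, ∀ u ∈ C, |b j u - a j| ≤ k) (havg : ∀ j, C.card * a j ≤ ∑ u ∈ C, b j u) :
    ∃ u ∈ C, ∑ j, Real.exp (-(r * b j u)) ≤
      Real.exp (r ^ 2 * k ^ 2) * ∑ j, Real.exp (-(r * a j)) := by
  apply Finset.exists_le_of_sum_le hC
  rw [Finset.sum_comm, Finset.sum_const, nsmul_eq_mul, Finset.mul_sum, Finset.mul_sum]
  refine Finset.sum_le_sum fun j _ => ?_
  have hstep : ∀ u ∈ C, Real.exp (-(r * b j u)) ≤
      Real.exp (-(r * a j)) * (1 - r * (b j u - a j) + r ^ 2 * k ^ 2) := by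
    intro u hu
    have hle := hab j u hu
    have hz : |r * (b j u - a j)| ≤ 1 := by
      rw [abs_mul, abs_of_nonneg hr]
      exact (mul_le_mul_of_nonneg_left hle hr).trans hk
    have hsq : (r * (b j u - a j)) ^ 2 ≤ r ^ 2 * k ^ 2 := by
      rw [mul_pow]
      refine mul_le_mul_of_nonneg_left ?_ (sq_nonneg r)
      rw [← sq_abs]
      exact pow_le_pow_left₀ (abs_nonneg _) hle 2
    have heq : Real.exp (-(r * b j u)) =
        Real.exp (-(r * a j)) * Real.exp (-(r * (b j u - a j))) := by
      rw [← Real.exp_add]; congr 1; ring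
    rw [heq]
    refine mul_le_mul_of_nonneg_left ?_ (Real.exp_pos _).le
    linarith [exp_neg_le_one_sub_add_sq hz]
  -- The linear term has nonnegative average by `havg`, so only the quadratic error remains, and 1 +
  -- r²k² is at most its exponential.
  refine (Finset.sum_le_sum hstep).trans ?_
  rw [← Finset.mul_sum, Finset.sum_add_distrib, Finset.sum_sub_distrib, ← Finset.mul_sum,
    Finset.sum_sub_distrib]
  simp only [Finset.sum_const, nsmul_eq_mul, mul_one]
  have h1 : 0 ≤ r * (∑ u ∈ C, b j u - C.card * a j) := mul_nonneg hr (by linarith [havg j])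
  have h2 : 1 + r ^ 2 * k ^ 2 ≤ Real.exp (r ^ 2 * k ^ 2) := by
    linarith [Real.add_one_le_exp (r ^ 2 * k ^ 2)]
  have h3 : (C.card : ℝ) - r * (∑ u ∈ C, b j u - C.card * a j) + C.card * (r ^ 2 * k ^ 2) ≤
      C.card * Real.exp (r ^ 2 * k ^ 2) := by
    have := mul_le_mul_of_nonneg_left h2 (Nat.cast_nonneg (α := ℝ) C.card)
    linarith
  calc _ ≤ Real.exp (-(r * a j)) * (C.card * Real.exp (r ^ 2 * k ^ 2)) :=
        mul_le_mul_of_nonneg_left h3 (Real.exp_pos _).le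
    _ = _ := by ring

/-- A sequential random choice, derandomized. The images of `0, …, N - 1` are chosen one after the
other, where `P x φ` says that the first `x` choices are admissible and `C x φ` is the set of
candidates for the next one. Each `s ∈ S` has a set `Q s` of steps, and for every `j` it succeeds
if at all these steps the choice lies in the prescribed set `Z j s x`. If every candidate set
meets the prescribed sets in proportion `β` and no step matters to too many `s`, then for all `j`
simultaneously at least half of the expected number of `s` succeed. -/
theorem exists_forall_half_le_card_success {V J : Type*} [Fintype J] (N : ℕ) (S : Finset ℕ)
    (Q : ℕ → Finset ℕ) (Z : J → ℕ → ℕ → Set V) (P : ℕ → (ℕ → V) → Prop)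
    (C : ℕ → (ℕ → V) → Finset V) (φ₀ : ℕ → V) {β L : ℝ} {d : ℕ}
    (hβ : 0 < β) (hβ1 : β ≤ 1) (hd : 0 < d) (hL : 1 ≤ L)
    (hQ : ∀ s ∈ S, Q s ⊆ Finset.range N) (hQd : ∀ s ∈ S, (Q s).card ≤ d)
    (hQL : ∀ x < N, ((S.filter (x ∈ Q ·)).card : ℝ) ≤ L)
    (hP0 : P 0 φ₀) (hCne : ∀ x < N, ∀ φ, P x φ → (C x φ).Nonempty)
    (hCP : ∀ x < N, ∀ φ, P x φ → ∀ u ∈ C x φ, P (x + 1) (Function.update φ x u))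
    (hCZ : ∀ x < N, ∀ φ, P x φ → ∀ j, ∀ s ∈ S, x ∈ Q s →
      β * (C x φ).card ≤ (({u | u ∈ C x φ ∧ u ∈ Z j s x} : Set V).ncard : ℝ))
    (hJ : Real.log (Fintype.card J) < β ^ (2 * d) * S.card / (16 * d * L)) :
    ∃ φ, P N φ ∧ ∀ j, β ^ d * S.card / 2 ≤
      (({s | s ∈ S ∧ ∀ x ∈ Q s, φ x ∈ Z j s x} : Set ℕ).ncard : ℝ) := by
  classical
  set k : ℕ → ℝ := fun x => ((S.filter (x ∈ Q ·)).card : ℝ) with hkdef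
  have hd' : (0 : ℝ) < d := by exact_mod_cast hd
  have hd1 : (1 : ℝ) ≤ d := by exact_mod_cast hd
  have hL0 : 0 < L := by linarith
  -- This r maximizes r β^d |S| / 2 - r² L d |S|, the exponent gained in the final comparison; the
  -- maximum is the bound in `hJ`.
  set r : ℝ := β ^ d / (4 * d * L) with hrdef
  have hr : 0 ≤ r := by positivity
  have hrL : r * L ≤ 1 := by
    have : r * L = β ^ d / (4 * d) := by rw [hrdef]; field_simp
    rw [this, div_le_one (by positivity)]
    have := pow_le_one₀ (n := d) hβ.le hβ1
    linarith
  set Y : J → ℕ → (ℕ → V) → ℝ := fun j x φ => ∑ s ∈ S, successWeight β (Q s) (Z j s) x φ with hY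
  have hmain : ∀ x ≤ N, ∃ φ, P x φ ∧ ∑ j, Real.exp (-(r * Y j x φ)) ≤
      Real.exp (r ^ 2 * ∑ y ∈ Finset.range x, k y ^ 2) * ∑ j, Real.exp (-(r * Y j 0 φ₀)) := by
    intro x
    induction x with
    | zero => intro _; exact ⟨φ₀, hP0, by simp⟩
    | succ x ih =>
      intro hx
      obtain ⟨φ, hPφ, hφ⟩ := ih (by omega)
      -- Weights lie in [0, 1], and only the s with x ∈ Q s notice the choice at step x.
      have hchange : ∀ j, ∀ u ∈ C x φ,
          |Y j (x + 1) (Function.update φ x u) - Y j x φ| ≤ k x := by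
        intro j u _
        simp only [hY, hkdef]
        rw [← Finset.sum_sub_distrib, Finset.card_filter, Nat.cast_sum]
        refine (Finset.abs_sum_le_sum_abs _ _).trans (Finset.sum_le_sum fun s _ => ?_)
        by_cases hxs : x ∈ Q s
        · simp only [hxs, if_true, Nat.cast_one]
          rw [abs_le]
          constructor <;>
          linarith [successWeight_nonneg (Q := Q s) (Z := Z j s) (x := x) (φ := φ) hβ.le,
            successWeight_le_one (Q := Q s) (Z := Z j s) (x := x) (φ := φ) hβ.le hβ1,
            successWeight_nonneg (Q := Q s) (Z := Z j s) (x := x + 1)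
              (φ := Function.update φ x u) hβ.le,
            successWeight_le_one (Q := Q s) (Z := Z j s) (x := x + 1)
              (φ := Function.update φ x u) hβ.le hβ1]
        · simp [successWeight_update_of_notMem hxs, hxs]
      have havg : ∀ j, (C x φ).card * Y j x φ ≤
          ∑ u ∈ C x φ, Y j (x + 1) (Function.update φ x u) := by
        intro j
        simp only [hY]
        rw [Finset.mul_sum, Finset.sum_comm]
        exact Finset.sum_le_sum fun s hs =>
          card_mul_successWeight_le hβ _ (hCZ x hx φ hPφ j s hs)
      obtain ⟨u, hu, hle⟩ := exists_sum_exp_neg_le (C x φ) (hCne x hx φ hPφ) (fun j => Y j x φ)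
        (fun j u => Y j (x + 1) (Function.update φ x u)) (r := r) (k := k x) hr
        ((mul_le_mul_of_nonneg_left (hQL x hx) hr).trans hrL) hchange havg
      refine ⟨Function.update φ x u, hCP x hx φ hPφ u hu, hle.trans ?_⟩
      rw [Finset.sum_range_succ, mul_add, add_comm, Real.exp_add, mul_assoc]
      exact mul_le_mul_of_nonneg_left hφ (Real.exp_pos _).le
  obtain ⟨φ, hPφ, hφ⟩ := hmain N le_rfl
  refine ⟨φ, hPφ, fun j => ?_⟩
  have hset : ({s | s ∈ S ∧ ∀ x ∈ Q s, φ x ∈ Z j s x} : Set ℕ) =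
      ↑(S.filter fun s => ∀ x ∈ Q s, φ x ∈ Z j s x) := by ext; simp
  rw [hset, Set.ncard_coe_finset]
  have hYN : Y j N φ = ((S.filter fun s => ∀ x ∈ Q s, φ x ∈ Z j s x).card : ℝ) := by
    rw [Finset.card_filter, Nat.cast_sum]
    refine Finset.sum_congr rfl fun s hs => ?_
    rw [successWeight_of_subset (hQ s hs)]
    split_ifs <;> simp
  rw [← hYN]
  -- One factor k y is bounded by L; the other is summed by double counting the pairs y ∈ Q s.
  have hk2 : ∑ y ∈ Finset.range N, k y ^ 2 ≤ L * (d * S.card) := by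
    have h1 : ∑ y ∈ Finset.range N, k y ^ 2 ≤ ∑ y ∈ Finset.range N, L * k y := by
      refine Finset.sum_le_sum fun y hy => ?_
      rw [sq]
      exact mul_le_mul_of_nonneg_right (hQL y (Finset.mem_range.1 hy)) (Nat.cast_nonneg _)
    have h2 : ∑ y ∈ Finset.range N, (S.filter (y ∈ Q ·)).card ≤ S.card * d := by
      simp only [Finset.card_filter]
      rw [Finset.sum_comm]
      refine (Finset.sum_le_card_nsmul _ _ d fun s hs => ?_).trans (by simp)
      rw [← Finset.card_filter]
      exact (Finset.card_le_card fun y hy => (Finset.mem_filter.1 hy).2).trans (hQd s hs)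
    rw [← Finset.mul_sum] at h1
    refine h1.trans (mul_le_mul_of_nonneg_left ?_ hL0.le)
    rw [mul_comm]
    simp only [hkdef]
    exact_mod_cast h2
  have hY0 : ∀ j, β ^ d * S.card ≤ Y j 0 φ₀ := by
    intro j
    simp only [hY, successWeight_zero]
    rw [mul_comm, ← nsmul_eq_mul]
    exact Finset.card_nsmul_le_sum _ _ _ fun s hs => pow_le_pow_of_le_one hβ.le hβ1 (hQd s hs)
  by_contra! hlt
  have hcard : 0 < (Fintype.card J : ℝ) := by exact_mod_cast Fintype.card_pos_iff.2 ⟨j⟩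
  have h1 : Real.exp (-(r * Y j N φ)) ≤ Real.exp (r ^ 2 * (L * (d * S.card))) *
      (Fintype.card J * Real.exp (-(r * (β ^ d * S.card)))) := by
    refine (Finset.single_le_sum (f := fun j => Real.exp (-(r * Y j N φ)))
      (fun _ _ => (Real.exp_pos _).le) (Finset.mem_univ j)).trans (hφ.trans ?_)
    refine mul_le_mul ?_ ?_ (Finset.sum_nonneg fun _ _ => (Real.exp_pos _).le) (Real.exp_pos _).le
    · exact Real.exp_le_exp.2 (mul_le_mul_of_nonneg_left hk2 (sq_nonneg r))
    · rw [← nsmul_eq_mul]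
      refine Finset.sum_le_card_nsmul _ _ _ fun j _ => Real.exp_le_exp.2 ?_
      exact neg_le_neg (mul_le_mul_of_nonneg_left (hY0 j) hr)
  rw [← Real.exp_log hcard, ← Real.exp_add, ← Real.exp_add, Real.exp_le_exp] at h1
  have h2 : r * Y j N φ ≤ r * (β ^ d * S.card / 2) := mul_le_mul_of_nonneg_left hlt.le hr
  have h3 : r * (β ^ d * S.card / 2) - r ^ 2 * (L * (d * S.card)) =
      β ^ (2 * d) * S.card / (16 * d * L) := by
    rw [hrdef, pow_mul']
    field_simp
    ring
  linarith

/-! ### Enumerations of trees and independent sets -/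

/-- The vertices of a finite tree can be listed as `e 0 = t, e 1, e 2, …` so that each vertex
after the first has exactly one neighbour among the earlier ones. -/
theorem SimpleGraph.IsTree.exists_enumeration {W : Type*} [Fintype W] {G : SimpleGraph W}
    (hG : G.IsTree) (t : W) :
    ∃ (e : ℕ → W) (par : ℕ → ℕ), e 0 = t ∧ Set.BijOn e (Set.Iio (Fintype.card W)) Set.univ ∧
      (∀ i, 0 < i → par i < i) ∧
      (∀ i, 0 < i → i < Fintype.card W → G.Adj (e (par i)) (e i)) ∧
      ∀ i j, i < j → j < Fintype.card W → G.Adj (e i) (e j) → i = par j := by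
  classical
  have key : ∀ k ≤ Fintype.card W, ∃ (e : ℕ → W) (par : ℕ → ℕ), e 0 = t ∧
      Set.InjOn e (Set.Iio k) ∧ (∀ i, 0 < i → par i < i) ∧
      ∀ i, 0 < i → i < k → G.Adj (e (par i)) (e i) := by
    intro k
    induction k with
    | zero =>
      intro _
      exact ⟨fun _ => t, fun _ => 0, rfl, by simp, fun i hi => hi, fun i _ hi => by omega⟩
    | succ k ih =>
      intro hk
      obtain ⟨e, par, he0, hinj, hpar, hadj⟩ := ih (by omega)
      rcases Nat.eq_zero_or_pos k with rfl | hk0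
      · refine ⟨e, par, he0, ?_, hpar, fun i h1 h2 => by omega⟩
        intro i hi j hj _
        simp only [Set.mem_Iio] at hi hj
        omega
      obtain ⟨z, hz⟩ : ∃ z, z ∉ e '' Set.Iio k := by
        by_contra! h
        have h1 : (Set.univ : Set W) ⊆ e '' Set.Iio k := fun z _ => h z
        have h2 := Set.ncard_le_ncard h1
        have h3 := Set.ncard_image_le (f := e) (Set.finite_Iio k)
        rw [Set.ncard_univ, Nat.card_eq_fintype_card] at h2
        have h4 : (Set.Iio k).ncard = k := by
          rw [← Finset.coe_range, Set.ncard_coe_finset, Finset.card_range]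
        omega
      obtain ⟨p⟩ := hG.connected t z
      -- A walk from t to an unlisted vertex must leave the listed set; the edge where it does so
      -- supplies the next vertex and its parent.
      obtain ⟨a, _, ha1, ha2⟩ := p.exists_boundary_dart (e '' Set.Iio k) ⟨0, hk0, he0⟩ hz
      obtain ⟨l, hl, hla⟩ := ha1
      refine ⟨Function.update e k a.snd, Function.update par k l, ?_, ?_, ?_, ?_⟩
      · rw [Function.update_of_ne hk0.ne, he0]
      · have hIio : Set.Iio (k + 1) = insert k (Set.Iio k) := by
          ext i; simp only [Set.mem_Iio, Set.mem_insert_iff]; omega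
        have hEq : Set.EqOn (Function.update e k a.snd) e (Set.Iio k) := fun i hi =>
          Function.update_of_ne (ne_of_lt hi) _ _
        rw [hIio, Set.injOn_insert (by simp)]
        refine ⟨hinj.congr hEq.symm, ?_⟩
        rw [hEq.image_eq, Function.update_self]
        exact ha2
      · intro i hi
        rcases eq_or_ne i k with rfl | h
        · rw [Function.update_self]; exact hl
        · rw [Function.update_of_ne h]; exact hpar i hi
      · intro i hi hik
        rcases eq_or_ne i k with rfl | h
        · have hli : l ≠ i := ne_of_lt hl
          rw [Function.update_self, Function.update_self, Function.update_of_ne hli, hla]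
          exact a.adj
        · have := hpar i hi
          rw [Function.update_of_ne h, Function.update_of_ne h,
            Function.update_of_ne (by omega)]
          exact hadj i hi (by omega)
  obtain ⟨e, par, he0, hinj, hpar, hadj⟩ := key _ le_rfl
  have hbij : Set.BijOn e (Set.Iio (Fintype.card W)) Set.univ := by
    refine ⟨Set.mapsTo_univ _ _, hinj, ?_⟩
    have h : e '' Set.Iio (Fintype.card W) = Set.univ := by
      refine Set.eq_of_subset_of_ncard_le (Set.subset_univ _) ?_
      rw [hinj.ncard_image, Set.ncard_univ, Nat.card_eq_fintype_card, ← Finset.coe_range,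
        Set.ncard_coe_finset, Finset.card_range]
    exact h.symm.subset
  refine ⟨e, par, he0, hbij, hpar, hadj, ?_⟩
  have hpos : 0 < Fintype.card W := Fintype.card_pos_iff.2 ⟨t⟩
  -- The parent edges are distinct and one fewer than the vertices, so they are all the edges of the
  -- tree. This gives uniqueness of the earlier neighbour.
  set F : Finset (Sym2 W) :=
    (Finset.Ico 1 (Fintype.card W)).image fun i => s(e (par i), e i) with hF
  have hFcard : F.card = Fintype.card W - 1 := by
    rw [hF, Finset.card_image_of_injOn, Nat.card_Ico]
    intro i hi j hj hij
    simp only [Finset.coe_Ico, Set.mem_Ico] at hi hj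
    have hi' := hpar i (by omega)
    have hj' := hpar j (by omega)
    rcases Sym2.eq_iff.1 hij with ⟨_, h⟩ | ⟨h1, h2⟩
    · exact hinj hi.2 hj.2 h
    · have h3 := hinj (show par i ∈ Set.Iio _ by simp only [Set.mem_Iio]; omega) hj.2 h1
      have h4 := hinj hi.2 (show par j ∈ Set.Iio _ by simp only [Set.mem_Iio]; omega) h2
      omega
  have hFsub : F ⊆ G.edgeFinset := by
    intro x hx
    obtain ⟨i, hi, rfl⟩ := Finset.mem_image.1 hx
    rw [Finset.mem_Ico] at hi
    rw [SimpleGraph.mem_edgeFinset, SimpleGraph.mem_edgeSet]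
    exact hadj i (by omega) hi.2
  have hFeq : F = G.edgeFinset := by
    refine Finset.eq_of_subset_of_card_le hFsub ?_
    have := hG.card_edgeFinset
    omega
  intro i j hij hj h
  have hmem : s(e i, e j) ∈ F := by
    rw [hFeq, SimpleGraph.mem_edgeFinset]; exact h
  obtain ⟨l, hl, hls⟩ := Finset.mem_image.1 hmem
  rw [Finset.mem_Ico] at hl
  have hl' := hpar l (by omega)
  rcases Sym2.eq_iff.1 hls with ⟨h1, h2⟩ | ⟨h1, h2⟩
  · have h3 := hinj hl.2 hj h2
    have h4 := hinj (show par l ∈ Set.Iio _ by simp only [Set.mem_Iio]; omega)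
      (show i ∈ Set.Iio _ by simp only [Set.mem_Iio]; omega) h1
    rw [← h3, h4]
  · have h3 := hinj hl.2 (show i ∈ Set.Iio _ by simp only [Set.mem_Iio]; omega) h2
    have h4 := hinj (show par l ∈ Set.Iio _ by simp only [Set.mem_Iio]; omega) hj h1
    omega

/-- The number of children of `x` among the first `N` vertices of a tree with parent map `par`. -/
def numChildren (par : ℕ → ℕ) (N x : ℕ) : ℕ :=
  ((Finset.range N).filter fun i => 0 < i ∧ par i = x).card

theorem sum_numChildren_le (par : ℕ → ℕ) (N : ℕ) :
    ∑ x ∈ Finset.range N, numChildren par N x ≤ N := by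
  have h := Finset.sum_card_fiberwise_eq_card_filter
    ((Finset.range N).filter (0 < ·)) (Finset.range N) par
  simp only [Finset.filter_filter] at h
  exact h.le.trans ((Finset.card_filter_le _ _).trans (by simp))

/-- A tree on `0, …, N - 1` has a large independent set of vertices that have at most one child
and are not the root. -/
theorem exists_independent_numChildren_le_one (par : ℕ → ℕ) (hpar : ∀ i, 0 < i → par i < i)
    (N : ℕ) :
    ∃ S : Finset ℕ, S ⊆ Finset.range N ∧ N ≤ 4 * S.card + 2 ∧
      ∀ s ∈ S, 0 < s ∧ numChildren par N s ≤ 1 ∧ par s ∉ S := by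
  classical
  -- A proper 2-colouring. At least half of the vertices have at most one child; discarding the root
  -- and keeping the larger colour class gives S.
  obtain ⟨col, hcol⟩ : ∃ col : ℕ → Bool, ∀ i, 0 < i → i < N → col i = !col (par i) := by
    induction N with
    | zero => exact ⟨fun _ => true, fun i _ h => by omega⟩
    | succ N ih =>
      obtain ⟨col, hcol⟩ := ih
      refine ⟨Function.update col N (!col (par N)), fun i hi hiN => ?_⟩
      have := hpar i hi
      rw [Function.update_of_ne (by omega : par i ≠ N)]
      rcases eq_or_ne i N with rfl | h
      · rw [Function.update_self]
      · rw [Function.update_of_ne h]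
        exact hcol i hi (by omega)
  set R := Finset.range N
  set H := R.filter fun s => numChildren par N s ≤ 1
  set H' := R.filter fun s => ¬ numChildren par N s ≤ 1
  have hH' : H'.card * 2 ≤ N := by
    refine le_trans ?_ (sum_numChildren_le par N)
    refine le_trans ?_ (Finset.sum_le_sum_of_subset (Finset.filter_subset _ _ : H' ⊆ R))
    rw [← smul_eq_mul]
    refine Finset.card_nsmul_le_sum _ _ _ fun s hs => ?_
    have := (Finset.mem_filter.1 hs).2
    omega
  have hHH' : H.card + H'.card = N := by
    rw [Finset.card_filter_add_card_filter_not, Finset.card_range]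
  set H₀ := H.erase 0
  have hH₀ : H.card ≤ H₀.card + 1 := by
    have : H.card - 1 ≤ H₀.card := Finset.pred_card_le_card_erase
    omega
  have hsplit := Finset.card_filter_add_card_filter_not (s := H₀) (fun s => col s = true)
  have hS : ∀ b, ∀ s ∈ H₀.filter (fun s => col s = b),
      0 < s ∧ s < N ∧ numChildren par N s ≤ 1 ∧ par s ∉ H₀.filter (fun s => col s = b) := by
    intro b s hs
    simp only [Finset.mem_filter, Finset.mem_erase, H₀, H, R, Finset.mem_range] at hs ⊢
    obtain ⟨⟨h0, h1, h2⟩, h3⟩ := hs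
    refine ⟨by omega, h1, h2, ?_⟩
    rintro ⟨_, h4⟩
    have := hcol s (by omega) h1
    rw [h4, h3] at this
    simp at this
  have fin : ∀ b, N ≤ 4 * (H₀.filter (fun s => col s = b)).card + 2 →
      ∃ S : Finset ℕ, S ⊆ Finset.range N ∧ N ≤ 4 * S.card + 2 ∧
      ∀ s ∈ S, 0 < s ∧ numChildren par N s ≤ 1 ∧ par s ∉ S := fun b hb =>
    ⟨_, fun s hs => Finset.mem_range.2 (hS b s hs).2.1, hb, fun s hs =>
      ⟨(hS b s hs).1, (hS b s hs).2.2⟩⟩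
  simp only [Bool.not_eq_true] at hsplit
  by_cases h : N ≤ 4 * (H₀.filter (fun s => col s = true)).card + 2
  · exact fin true h
  · exact fin false (by omega)

/-! ### Partial copies and switching -/

namespace Digraph

variable {V : Type*}

/-- `D.Arc b u v` is the edge `uv` if `b` is true and the edge `vu` otherwise. -/
def Arc (D : Digraph V) (b : Bool) (u v : V) : Prop := cond b (D.Adj u v) (D.Adj v u)

theorem arc_not (D : Digraph V) (b : Bool) (u v : V) : D.Arc (!b) u v ↔ D.Arc b v u := by
  cases b <;> exact Iff.rfl

/-- `φ` embeds the subtree on `0, …, k - 1` of the tree in which `i > 0` is joined to its parent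
`par i` by an edge that points towards `i` exactly if `dir i` is true. -/
structure IsPartialCopy (D : Digraph V) (par : ℕ → ℕ) (dir : ℕ → Bool) (k : ℕ) (φ : ℕ → V) :
    Prop where
  injOn : Set.InjOn φ (Set.Iio k)
  arc : ∀ i, 0 < i → i < k → D.Arc (dir i) (φ (par i)) (φ i)

/-- The vertex `s` can be moved to `v`, after which its former place is a `b`-neighbour of `p`
that is free. -/
structure IsSwitchable (D : Digraph V) (par : ℕ → ℕ) (dir : ℕ → Bool) (N : ℕ) (φ : ℕ → V)
    (b : Bool) (p v : V) (s : ℕ) : Prop where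
  arc_self : D.Arc b p (φ s)
  arc_parent : D.Arc (dir s) (φ (par s)) v
  arc_child : ∀ i, 0 < i → i < N → par i = s → D.Arc (dir i) v (φ i)

variable {D : Digraph V} {par : ℕ → ℕ} {dir : ℕ → Bool} {k N : ℕ} {φ : ℕ → V}

theorem IsPartialCopy.update (h : D.IsPartialCopy par dir k φ) (hpar : ∀ i, 0 < i → par i < i)
    {u : V} (hu : u ∉ φ '' Set.Iio k) (harc : 0 < k → D.Arc (dir k) (φ (par k)) u) :
    D.IsPartialCopy par dir (k + 1) (Function.update φ k u) := by
  constructor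
  · have hIio : Set.Iio (k + 1) = insert k (Set.Iio k) := by
      ext i; simp only [Set.mem_Iio, Set.mem_insert_iff]; omega
    have hEq : Set.EqOn (Function.update φ k u) φ (Set.Iio k) := fun i hi =>
      Function.update_of_ne (ne_of_lt hi) _ _
    rw [hIio, Set.injOn_insert (by simp), hEq.image_eq, Function.update_self]
    exact ⟨h.injOn.congr hEq.symm, hu⟩
  · intro i hi hik
    have hp := hpar i hi
    rw [Function.update_of_ne (by omega : par i ≠ k)]
    rcases eq_or_ne i k with rfl | hne
    · rw [Function.update_self]; exact harc hi
    · rw [Function.update_of_ne hne]; exact h.arc i hi (by omega)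

/-- Moving a switchable vertex `s` to a free vertex `v`. -/
theorem IsPartialCopy.update_of_arc (h : D.IsPartialCopy par dir k φ)
    (hpar : ∀ i, 0 < i → par i < i) {s : ℕ} {v : V} (hv : v ∉ φ '' Set.Iio k)
    (hs : 0 < s → D.Arc (dir s) (φ (par s)) v)
    (hs' : ∀ i, 0 < i → i < k → par i = s → D.Arc (dir i) v (φ i)) :
    D.IsPartialCopy par dir k (Function.update φ s v) := by
  constructor
  · intro i hi j hj hij
    by_cases his : i = s <;> by_cases hjs : j = s
    · rw [his, hjs]
    · subst his
      rw [Function.update_self, Function.update_of_ne hjs] at hij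
      exact (hv ⟨j, hj, hij.symm⟩).elim
    · subst hjs
      rw [Function.update_self, Function.update_of_ne his] at hij
      exact (hv ⟨i, hi, hij⟩).elim
    · rw [Function.update_of_ne his, Function.update_of_ne hjs] at hij
      exact h.injOn hi hj hij
  · intro i hi hik
    have hp := hpar i hi
    by_cases his : i = s
    · subst his
      rw [Function.update_self, Function.update_of_ne hp.ne]
      exact hs hi
    · rw [Function.update_of_ne his]
      by_cases hps : par i = s
      · rw [hps, Function.update_self]
        exact hs' i hi hik hps
      · rw [Function.update_of_ne hps]
        exact h.arc i hi hik

/-- An embedding of a subtree with many switchable vertices extends to an embedding of the whole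
tree into any vertex set of the right size that contains its image. -/
theorem IsPartialCopy.exists_extension (hφ : D.IsPartialCopy par dir N φ)
    (hpar : ∀ i, 0 < i → par i < i) {S : Finset ℕ} (hSN : S ⊆ Finset.range N)
    (hS : ∀ s ∈ S, 0 < s ∧ par s ∉ S) {B : Finset V} (hB : ∀ i < N, φ i ∈ B) {M : ℕ}
    (hBM : B.card = N + M) (hN : 0 < N)
    (hgood : ∀ b p v, 2 * M < ({s | s ∈ S ∧ D.IsSwitchable par dir N φ b p v s} : Set ℕ).ncard) :
    ∃ ψ, D.IsPartialCopy par dir (N + M) ψ ∧ (∀ i < N + M, ψ i ∈ B) ∧ ψ 0 = φ 0 := by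
  classical
  -- U collects the spent vertices, two per step: the moved s and the parent of the new vertex.
  -- Initial vertices outside S never move, and an unspent s ∈ S is in place with no new children.
  -- By independence the parent and initial children of s lie outside S, so switchability with
  -- respect to φ stays valid for ψ.
  have key : ∀ k ≤ M, ∃ (ψ : ℕ → V) (U : Finset ℕ), D.IsPartialCopy par dir (N + k) ψ ∧
      (∀ i < N + k, ψ i ∈ B) ∧ U.card ≤ 2 * k ∧ (∀ i < N, i ∉ S → ψ i = φ i) ∧
      ∀ s ∈ S, s ∉ U → ψ s = φ s ∧ ∀ i, N ≤ i → i < N + k → par i ≠ s := by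
    intro k
    induction k with
    | zero =>
      intro _
      exact ⟨φ, ∅, hφ, hB, by simp, fun _ _ _ => rfl, fun s _ _ => ⟨rfl, fun i h1 h2 => by omega⟩⟩
    | succ k ih =>
      intro hk
      obtain ⟨ψ, U, hψ, hψB, hU, hψφ, hψS⟩ := ih (by omega)
      obtain ⟨v, hvB, hv⟩ : ∃ v ∈ B, v ∉ (Finset.range (N + k)).image ψ := by
        refine Finset.exists_mem_notMem_of_card_lt_card ?_
        refine (Finset.card_image_le).trans_lt ?_
        rw [Finset.card_range, hBM]
        omega
      have hv' : v ∉ ψ '' Set.Iio (N + k) := fun ⟨i, hi, hiv⟩ =>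
        hv (Finset.mem_image.2 ⟨i, Finset.mem_range.2 hi, hiv⟩)
      -- The current parent is excluded too, since moving it would change the vertex p to which the
      -- new vertex is attached.
      obtain ⟨s, ⟨hsS, hs⟩, hsU⟩ : ∃ s ∈ ({s | s ∈ S ∧ D.IsSwitchable par dir N φ (dir (N + k))
          (ψ (par (N + k))) v s} : Set ℕ), s ∉ (↑(insert (par (N + k)) U) : Set ℕ) := by
        refine Set.exists_mem_notMem_of_ncard_lt_ncard ?_
        rw [Set.ncard_coe_finset]
        have h1 := Finset.card_insert_le (par (N + k)) U
        have h2 := hgood (dir (N + k)) (ψ (par (N + k))) v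
        omega
      rw [Finset.mem_coe, Finset.mem_insert, not_or] at hsU
      obtain ⟨hsp, hsU⟩ := hsU
      have hsN : s < N := Finset.mem_range.1 (hSN hsS)
      obtain ⟨hs0, hsps⟩ := hS s hsS
      obtain ⟨hψs, hchild⟩ := hψS s hsS hsU
      have hps := hpar s hs0
      have h1 : D.IsPartialCopy par dir (N + k) (Function.update ψ s v) := by
        refine hψ.update_of_arc hpar hv' (fun _ => ?_) fun i hi hik his => ?_
        · rw [hψφ (par s) (by omega) hsps]
          exact hs.arc_parent
        · have hiN : i < N := by
            by_contra hge
            exact hchild i (by omega) hik his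
          have hiS : i ∉ S := fun hiS => (hS i hiS).2 (his ▸ hsS)
          rw [hψφ i hiN hiS]
          exact hs.arc_child i hi hiN his
      have hKp := hpar (N + k) (by omega)
      have h2 : D.IsPartialCopy par dir (N + (k + 1))
          (Function.update (Function.update ψ s v) (N + k) (φ s)) := by
        refine h1.update hpar ?_ fun _ => ?_
        · rintro ⟨i, hi, his⟩
          by_cases h : i = s
          · subst h
            rw [Function.update_self, ← hψs] at his
            exact hv' ⟨i, hi, his.symm⟩
          · rw [Function.update_of_ne h, ← hψs] at his
            exact h (hψ.injOn hi (show s ∈ Set.Iio (N + k) by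
              simp only [Set.mem_Iio]; omega) his)
        · rw [Function.update_of_ne (Ne.symm hsp)]
          exact hs.arc_self
      refine ⟨_, insert s (insert (par (N + k)) U), h2, ?_, ?_, ?_, ?_⟩
      · intro i hi
        by_cases hik : i = N + k
        · rw [hik, Function.update_self]; exact hB s hsN
        · rw [Function.update_of_ne hik]
          by_cases his : i = s
          · rw [his, Function.update_self]; exact hvB
          · rw [Function.update_of_ne his]; exact hψB i (by omega)
      · have h3 := Finset.card_insert_le s (insert (par (N + k)) U)
        have h4 := Finset.card_insert_le (par (N + k)) U
        omega
      · intro i hi hiS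
        have his : i ≠ s := fun h => hiS (h ▸ hsS)
        rw [Function.update_of_ne (by omega), Function.update_of_ne his]
        exact hψφ i hi hiS
      · intro s' hs' hs'U
        simp only [Finset.mem_insert, not_or] at hs'U
        have hs'N : s' < N := Finset.mem_range.1 (hSN hs')
        obtain ⟨h3, h4⟩ := hψS s' hs' hs'U.2.2
        rw [Function.update_of_ne (by omega), Function.update_of_ne hs'U.1]
        refine ⟨h3, fun i hi hik => ?_⟩
        by_cases h : i = N + k
        · rw [h]; exact Ne.symm hs'U.2.1
        · exact h4 i hi (by omega)
  obtain ⟨ψ, _, h1, h2, _, h3, _⟩ := key M le_rfl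
  exact ⟨ψ, h1, h2, h3 0 hN fun h => (hS 0 h).1.ne rfl⟩

/-! ### A random greedy embedding -/

/-- In a digraph of large minimum semidegree every small tree has an embedding with many
switchable vertices for all choices of the parameters. -/
theorem exists_isPartialCopy_switchable [Fintype V] [Nonempty V] (D : Digraph V)
    {α β L : ℝ} (hdeg : ∀ b u, (1 / 2 + α) * Fintype.card V ≤ (({w | D.Arc b u w} : Set V).ncard : ℝ))
    (hpar : ∀ i, 0 < i → par i < i) (dir : ℕ → Bool)
    {S : Finset ℕ} (hSN : S ⊆ Finset.range N) (hS : ∀ s ∈ S, 0 < s ∧ numChildren par N s ≤ 1)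
    (hβ : 0 < β) (hβ1 : β ≤ 1) (hNβ : β * Fintype.card V + N ≤ 2 * α * Fintype.card V)
    (hL : ∀ x < N, (numChildren par N x : ℝ) + 2 ≤ L) (hL1 : 1 ≤ L)
    (hlog : Real.log (2 * (Fintype.card V : ℝ) ^ 2) < β ^ 6 * S.card / (48 * L)) :
    ∃ φ, D.IsPartialCopy par dir N φ ∧ ∀ b p v, β ^ 3 * S.card / 2 ≤
      (({s | s ∈ S ∧ D.IsSwitchable par dir N φ b p v s} : Set ℕ).ncard : ℝ) := by
  classical
  set n := Fintype.card V with hn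
  have hn0 : 0 < (n : ℝ) := by exact_mod_cast Fintype.card_pos
  set Q : ℕ → Finset ℕ := fun s =>
    (Finset.range N).filter fun x => x = s ∨ x = par s ∨ (0 < x ∧ par x = s) with hQ
  -- For x ∈ Q s, the cases x = s, x < s and x > s are s itself, its parent and its children. The
  -- parent edge is read from v towards the parent, hence the negated direction.
  set Z : Bool × V × V → ℕ → ℕ → Set V := fun j s x =>
    {u | D.Arc (if x = s then j.1 else if x < s then !dir s else dir x)
      (if x = s then j.2.1 else j.2.2) u} with hZ
  set C : ℕ → (ℕ → V) → Finset V := fun x φ => Finset.univ.filter fun u =>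
    u ∉ φ '' Set.Iio x ∧ (0 < x → D.Arc (dir x) (φ (par x)) u) with hC
  -- Two neighbourhoods meet in at least 2αn vertices, of which fewer than N are occupied. The bound
  -- βn is absolute, so it also bounds the proportion among the candidates.
  have hcand : ∀ x < N, ∀ (φ : ℕ → V) b q,
      β * n ≤ (({u | u ∈ C x φ ∧ D.Arc b q u} : Set V).ncard : ℝ) := by
    intro x hx φ b q
    set A₁ : Finset V := Finset.univ.filter fun u => 0 < x → D.Arc (dir x) (φ (par x)) u with hA₁
    set A₂ : Finset V := Finset.univ.filter fun u => D.Arc b q u with hA₂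
    have h2 : (1 / 2 + α) * n ≤ A₂.card := by
      have := hdeg b q
      rwa [show ({w | D.Arc b q w} : Set V) = ↑A₂ by ext; simp [hA₂], Set.ncard_coe_finset] at this
    have h1 : (1 / 2 + α) * n ≤ A₁.card := by
      have h3 := hdeg (dir x) (φ (par x))
      rw [show ({w | D.Arc (dir x) (φ (par x)) w} : Set V) =
        ↑(Finset.univ.filter fun u => D.Arc (dir x) (φ (par x)) u) by ext; simp,
        Set.ncard_coe_finset] at h3
      refine h3.trans ?_
      exact_mod_cast Finset.card_le_card (Finset.monotone_filter_right _ fun u _ h _ => h)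
    have h3 : A₁.card + A₂.card ≤ n + (A₁ ∩ A₂).card := by
      have h4 := Finset.card_union_add_card_inter A₁ A₂
      have h5 := Finset.card_le_univ (A₁ ∪ A₂)
      omega
    have h4 : (A₁ ∩ A₂).card ≤ ((A₁ ∩ A₂) \ (Finset.range x).image φ).card + x := by
      have h5 := Finset.card_le_card_sdiff_add_card (s := A₁ ∩ A₂) (t := (Finset.range x).image φ)
      have h6 := Finset.card_image_le (s := Finset.range x) (f := φ)
      rw [Finset.card_range] at h6
      omega
    have h5 : ({u | u ∈ C x φ ∧ D.Arc b q u} : Set V) =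
        ↑((A₁ ∩ A₂) \ (Finset.range x).image φ) := by
      ext u
      simp [hC, hA₁, hA₂]
      tauto
    rw [h5, Set.ncard_coe_finset]
    have h3' : (A₁.card : ℝ) + A₂.card ≤ n + (A₁ ∩ A₂).card := by exact_mod_cast h3
    have h4' : ((A₁ ∩ A₂).card : ℝ) ≤
      ((A₁ ∩ A₂) \ (Finset.range x).image φ).card + x := by exact_mod_cast h4
    have hx' : (x : ℝ) ≤ N := by exact_mod_cast hx.le
    linarith
  obtain ⟨u₀⟩ := ‹Nonempty V›
  have hmemQ : ∀ s ∈ S, ∀ x, x ∈ Q s ↔ x = s ∨ x = par s ∨ (0 < x ∧ x < N ∧ par x = s) := by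
    intro s hs x
    have h1 := Finset.mem_range.1 (hSN hs)
    have h2 := hpar s (hS s hs).1
    simp only [hQ, Finset.mem_filter, Finset.mem_range]
    constructor
    · tauto
    · rintro (rfl | rfl | h)
      · exact ⟨h1, Or.inl rfl⟩
      · exact ⟨by omega, Or.inr (Or.inl rfl)⟩
      · exact ⟨h.2.1, Or.inr (Or.inr ⟨h.1, h.2.2⟩)⟩
  have hQ3 : ∀ s ∈ S, (Q s).card ≤ 3 := by
    intro s hs
    have hsub : Q s ⊆ insert s (insert (par s)
        ((Finset.range N).filter fun i => 0 < i ∧ par i = s)) := by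
      intro x hx
      rw [hmemQ s hs] at hx
      simp only [Finset.mem_insert, Finset.mem_filter, Finset.mem_range]
      tauto
    have h1 := Finset.card_le_card hsub
    have h2 := Finset.card_insert_le s (insert (par s)
      ((Finset.range N).filter fun i => 0 < i ∧ par i = s))
    have h3 := Finset.card_insert_le (par s) ((Finset.range N).filter fun i => 0 < i ∧ par i = s)
    have h4 := (hS s hs).2
    unfold numChildren at h4
    omega
  have hQL : ∀ x < N, ((S.filter (x ∈ Q ·)).card : ℝ) ≤ L := by
    intro x hx
    -- Step x matters only to x, its parent and its children, whence the 2 added to `numChildren`.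
    have hsub : S.filter (x ∈ Q ·) ⊆ insert x (insert (par x)
        ((Finset.range N).filter fun i => 0 < i ∧ par i = x)) := by
      intro s hs
      obtain ⟨hsS, hs⟩ := Finset.mem_filter.1 hs
      rw [hmemQ s hsS] at hs
      have h1 := Finset.mem_range.1 (hSN hsS)
      have h2 := (hS s hsS).1
      simp only [Finset.mem_insert, Finset.mem_filter, Finset.mem_range]
      rcases hs with h | h | h
      · exact Or.inl h.symm
      · exact Or.inr (Or.inr ⟨h1, h2, h.symm⟩)
      · exact Or.inr (Or.inl h.2.2.symm)
    have h1 := Finset.card_le_card hsub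
    have h2 := Finset.card_insert_le x (insert (par x)
      ((Finset.range N).filter fun i => 0 < i ∧ par i = x))
    have h3 := Finset.card_insert_le (par x) ((Finset.range N).filter fun i => 0 < i ∧ par i = x)
    have h4 : (S.filter (x ∈ Q ·)).card ≤ numChildren par N x + 2 := by
      unfold numChildren
      omega
    refine le_trans ?_ (hL x hx)
    exact_mod_cast h4
  have hCne : ∀ x < N, ∀ φ, D.IsPartialCopy par dir x φ → (C x φ).Nonempty := by
    intro x hx φ _
    have h := hcand x hx φ true u₀
    have hpos : 0 < ({u | u ∈ C x φ ∧ D.Arc true u₀ u} : Set V).ncard := by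
      have : 0 < β * n := by positivity
      exact_mod_cast this.trans_le h
    obtain ⟨u, hu, _⟩ := Set.nonempty_of_ncard_ne_zero hpos.ne'
    exact ⟨u, hu⟩
  have hCP : ∀ x < N, ∀ φ, D.IsPartialCopy par dir x φ → ∀ u ∈ C x φ,
      D.IsPartialCopy par dir (x + 1) (Function.update φ x u) := by
    intro x hx φ hφ u hu
    obtain ⟨h1, h2⟩ := (Finset.mem_filter.1 hu).2
    exact hφ.update hpar h1 h2
  have hCZ : ∀ x < N, ∀ φ, D.IsPartialCopy par dir x φ → ∀ j, ∀ s ∈ S, x ∈ Q s →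
      β * (C x φ).card ≤ (({u | u ∈ C x φ ∧ u ∈ Z j s x} : Set V).ncard : ℝ) := by
    intro x hx φ _ j s _ _
    refine le_trans (mul_le_mul_of_nonneg_left ?_ hβ.le) (hcand x hx φ _ _)
    exact_mod_cast Finset.card_le_univ _
  have hlogJ : Real.log (Fintype.card (Bool × V × V)) <
      β ^ (2 * 3) * S.card / (16 * (3 : ℕ) * L) := by
    have h1 : ((Fintype.card (Bool × V × V) : ℕ) : ℝ) = 2 * (n : ℝ) ^ 2 := by
      simp [Fintype.card_prod, hn, sq]
    rw [h1]
    norm_num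
    exact hlog
  obtain ⟨φ, hφ, hsucc⟩ := exists_forall_half_le_card_success N S Q Z
    (D.IsPartialCopy par dir) C (fun _ => u₀) hβ hβ1 (by norm_num) hL1
    (fun s _ => Finset.filter_subset _ _) hQ3 hQL ⟨by simp, fun i _ h => by omega⟩
    hCne hCP hCZ hlogJ
  refine ⟨φ, hφ, fun b p v => (hsucc (b, p, v)).trans ?_⟩
  have hsub : ({s | s ∈ S ∧ ∀ x ∈ Q s, φ x ∈ Z (b, p, v) s x} : Set ℕ) ⊆
      {s | s ∈ S ∧ D.IsSwitchable par dir N φ b p v s} := by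
    rintro s ⟨hsS, hs⟩
    have hps := hpar s (hS s hsS).1
    refine ⟨hsS, ?_, ?_, ?_⟩
    · have := hs s ((hmemQ s hsS s).2 (Or.inl rfl))
      simpa [hZ] using this
    · have := hs (par s) ((hmemQ s hsS _).2 (Or.inr (Or.inl rfl)))
      simp only [hZ, Set.mem_ofPred_eq, if_neg hps.ne, if_pos hps] at this
      exact (D.arc_not _ _ _).1 this
    · intro i hi hiN his
      have := hs i ((hmemQ s hsS _).2 (Or.inr (Or.inr ⟨hi, hiN, his⟩)))
      have hlt : s < i := his ▸ hpar i hi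
      simpa only [hZ, Set.mem_ofPred_eq, if_neg hlt.ne', if_neg hlt.not_gt] using this
  exact_mod_cast Set.ncard_le_ncard hsub (S.finite_toSet.subset fun s hs => hs.1)

end Digraph

/-! ### From enumerated trees to copies of T -/

namespace Digraph

theorem minSemidegree_le_ncard_arc {V : Type*} (D : Digraph V) (b : Bool) (u : V) :
    D.minSemidegree ≤ ({w | D.Arc b u w} : Set V).ncard := by
  have h : D.minSemidegree ≤ min (D.outDegree u) (D.inDegree u) :=
    ciInf_le (OrderBot.bddBelow _) u
  cases b
  · exact h.trans (min_le_right _ _)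
  · exact h.trans (min_le_left _ _)

theorem numChildren_le_degree {W : Type*} [Fintype W] {T : Digraph W} {e : ℕ → W} {par : ℕ → ℕ}
    {N : ℕ} (hinj : Set.InjOn e (Set.Iio N))
    (hadj : ∀ i, 0 < i → i < N → T.Adj (e (par i)) (e i) ∨ T.Adj (e i) (e (par i))) (x : ℕ) :
    numChildren par N x ≤ T.maxOutDegree + T.maxInDegree := by
  classical
  set F := (Finset.range N).filter fun i => 0 < i ∧ par i = x with hF
  have hmem : ∀ i ∈ F, i < N ∧ 0 < i ∧ par i = x := fun i hi => by simpa [hF] using hi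
  have hsub : e '' F ⊆ {w | T.Adj (e x) w} ∪ {w | T.Adj w (e x)} := by
    rintro _ ⟨i, hi, rfl⟩
    obtain ⟨h1, h2, h3⟩ := hmem i hi
    have := hadj i h2 h1
    rw [h3] at this
    exact this
  have h1 : (e '' F).ncard = numChildren par N x := by
    rw [(hinj.mono fun i hi => (hmem i hi).1).ncard_image, Set.ncard_coe_finset]
    rfl
  rw [← h1]
  refine (Set.ncard_le_ncard hsub).trans ((Set.ncard_union_le _ _).trans ?_)
  exact add_le_add (Finset.le_sup (f := T.outDegree) (Finset.mem_univ _))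
    (Finset.le_sup (f := T.inDegree) (Finset.mem_univ _))

/-- An embedding of an enumerated oriented tree gives a copy of it in any vertex set that contains
the image. -/
theorem IsPartialCopy.exists_copy {V W : Type*} {D : Digraph V} {T : Digraph W}
    (hT : T.IsOrientedTree) {e : ℕ → W} {par : ℕ → ℕ} {dir : ℕ → Bool} {m : ℕ}
    (he : Set.BijOn e (Set.Iio m) Set.univ) (hm : 0 < m)
    (hdir : ∀ i, dir i = true ↔ T.Adj (e (par i)) (e i))
    (huniq : ∀ i j, i < j → j < m → T.toSimpleGraphInclusive.Adj (e i) (e j) → i = par j)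
    {ψ : ℕ → V} (hψ : D.IsPartialCopy par dir m ψ) {B : Finset V} (hB : ∀ i < m, ψ i ∈ B) :
    ∃ φ : T.Copy (D.inducedOn B), (φ.toEmbedding (e 0) : V) = ψ 0 := by
  have hsurj : ∀ w, ∃ i < m, e i = w := fun w => he.surjOn (Set.mem_univ w)
  choose g hgm hge using hsurj
  refine ⟨⟨⟨fun w => ⟨ψ (g w), hB _ (hgm w)⟩, fun a b hab => ?_⟩, fun a b hab => ?_⟩, ?_⟩
  · have h := hψ.injOn (hgm a) (hgm b) (congrArg Subtype.val hab)
    rw [← hge a, ← hge b, h]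
  · change D.Adj (ψ (g a)) (ψ (g b))
    rw [← hge a, ← hge b] at hab
    -- Asymmetry also rules out loops, so the edge survives in the simple graph and joins a vertex
    -- to its parent.
    have hne : e (g a) ≠ e (g b) := fun h => hT.asymm _ _ hab (by rw [h] at hab ⊢; exact hab)
    rcases lt_trichotomy (g a) (g b) with h | h | h
    · have hp := huniq _ _ h (hgm b) ⟨hne, Or.inl hab⟩
      have harc := hψ.arc (g b) (by omega) (hgm b)
      rw [← hp, (hdir (g b)).2 (hp ▸ hab)] at harc
      exact harc
    · exact (hne (congrArg e h)).elim
    · have hp := huniq _ _ h (hgm a) ⟨hne.symm, Or.inr hab⟩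
      have harc := hψ.arc (g a) (by omega) (hgm a)
      have hfalse : dir (g a) = false := by
        rw [Bool.eq_false_iff]
        intro h'
        exact hT.asymm _ _ hab (hp ▸ (hdir (g a)).1 h')
      rw [← hp, hfalse] at harc
      exact harc
  · change ψ (g (e 0)) = ψ 0
    rw [he.injOn (hgm _) hm (hge (e 0))]

end Digraph

/-! ### Numerical estimates -/

theorem hierarchy_bounds {μ ε c x : ℝ} (hμ : 0 < μ) (hμ1 : μ ≤ 1) (hε : 0 < ε)
    (hεμ : ε ≤ μ ^ 4 / 128) (hc : 0 < c) (hcε : c ≤ ε ^ 2) (hx : 16 ≤ c ^ 2 * x) :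
    c ≤ μ ^ 8 / 16384 ∧ c ≤ 1 / 16384 ∧ ε ≤ μ / 128 ∧ 1000 ≤ μ ^ 4 * x ∧ 1000 ≤ μ * x := by
  have hx0 : 0 < x := by
    by_contra! h
    nlinarith [sq_nonneg c, mul_nonpos_of_nonneg_of_nonpos (sq_nonneg c) h]
  have h1 : c ≤ μ ^ 8 / 16384 := by
    have := pow_le_pow_left₀ hε.le hεμ 2
    calc c ≤ ε ^ 2 := hcε
      _ ≤ (μ ^ 4 / 128) ^ 2 := this
      _ = _ := by ring
  have hp8 : μ ^ 8 ≤ 1 := pow_le_one₀ hμ.le hμ1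
  have hp84 : μ ^ 8 ≤ μ ^ 4 := pow_le_pow_of_le_one hμ.le hμ1 (by norm_num)
  have hp4 : μ ^ 4 ≤ μ := by simpa using pow_le_pow_of_le_one hμ.le hμ1 (show 1 ≤ 4 by norm_num)
  have hc1 : c ≤ 1 / 16384 := by linarith
  have hcx : 16 ≤ c * x := by
    have : c ^ 2 * x ≤ c * x := by
      refine mul_le_mul_of_nonneg_right ?_ hx0.le
      nlinarith
    linarith
  have h4 : c * x ≤ μ ^ 4 / 16384 * x := mul_le_mul_of_nonneg_right (by linarith) hx0.le
  have h5 : μ ^ 4 * x ≤ μ * x := mul_le_mul_of_nonneg_right hp4 hx0.le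
  exact ⟨h1, hc1, by linarith, by linarith, by linarith⟩

/-- This is the union bound, with x in the role of n. Since log x ≤ 2√x ≤ cx, the additive 2 is
absorbed and the denominator is of order cx / log x. The right side then has order μ⁷ log x / c,
which exceeds 3 log x once 4608c < μ⁷; the logarithm in the degree bound is what makes this work. -/
theorem log_two_mul_sq_lt {μ c x s : ℝ} (hμ : 0 < μ) (hμ1 : μ ≤ 1) (hc : 0 < c)
    (hcμ : c ≤ μ ^ 8 / 16384) (hc1 : c ≤ 1 / 16384) (hx : 16 ≤ c ^ 2 * x) (hs : μ * x / 8 ≤ s) :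
    0 < Real.log x ∧
      Real.log (2 * x ^ 2) < μ ^ 6 * s / (48 * (2 * (c * x / Real.log x) + 2)) := by
  have hx0 : 0 < x := by
    by_contra! h
    nlinarith [sq_nonneg c, mul_nonpos_of_nonneg_of_nonpos (sq_nonneg c) h]
  have hx2 : 2 < x := by
    have : c ^ 2 * x ≤ 1 * x := mul_le_mul_of_nonneg_right (by nlinarith) hx0.le
    linarith
  have hl : 0 < Real.log x := Real.log_pos (by linarith)
  refine ⟨hl, ?_⟩
  have hsq : 0 < √x := Real.sqrt_pos.2 hx0
  have hsqx : √x * √x = x := Real.mul_self_sqrt hx0.le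
  have hl2 : Real.log x ≤ 2 * √x := by
    have h1 := Real.log_le_sub_one_of_pos hsq
    have h2 : Real.log x = 2 * Real.log (√x) := by
      rw [Real.log_sqrt hx0.le]; ring
    linarith
  have hcs : 2 ≤ c * √x := by
    by_contra! h
    have : (c * √x) ^ 2 < 2 ^ 2 := pow_lt_pow_left₀ h (by positivity) (by norm_num)
    nlinarith
  have hlc : Real.log x ≤ c * x := by
    calc Real.log x ≤ 2 * √x := hl2
      _ ≤ c * √x * √x := mul_le_mul_of_nonneg_right hcs hsq.le
      _ = c * x := by rw [mul_assoc, hsqx]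
  have hL : 2 * (c * x / Real.log x) + 2 ≤ 4 * (c * x / Real.log x) := by
    have : 1 ≤ c * x / Real.log x := (one_le_div hl).2 hlc
    linarith
  have hlog : Real.log (2 * x ^ 2) ≤ 3 * Real.log x := by
    rw [Real.log_mul (by norm_num) (by positivity), Real.log_pow]
    have := Real.log_le_log (by norm_num) hx2.le
    push_cast
    linarith
  have hp87 : μ ^ 8 ≤ μ ^ 7 := pow_le_pow_of_le_one hμ.le hμ1 (by norm_num)
  have hp7 : 0 < μ ^ 7 := by positivity
  have hcx : 0 < c * x := by positivity
  have hq : 0 < c * x / Real.log x := by positivity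
  calc Real.log (2 * x ^ 2) ≤ 3 * Real.log x := hlog
    _ < μ ^ 7 * Real.log x / (1536 * c) := by
        rw [lt_div_iff₀ (by positivity)]
        have : c * 4608 < μ ^ 7 := by linarith
        nlinarith
    _ = μ ^ 6 * (μ * x / 8) / (48 * (4 * (c * x / Real.log x))) := by
        field_simp
        ring
    _ ≤ μ ^ 6 * s / (48 * (4 * (c * x / Real.log x))) := by gcongr
    _ ≤ _ := by
        have hs0 : 0 ≤ s := le_trans (by positivity) hs
        gcongr

/-! ### Assembly -/

theorem theorem2 :
    ∃ f₁ f₂ f₃ f₄ : ℝ → ℝ,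
      IsHierarchyFun f₁ ∧ IsHierarchyFun f₂ ∧ IsHierarchyFun f₃ ∧ IsHierarchyFun f₄ ∧
      ∀ (α μ ε c : ℝ) (n : ℕ),
        α ∈ Set.Ioc (0 : ℝ) 1 → μ ∈ Set.Ioc (0 : ℝ) 1 → ε ∈ Set.Ioc (0 : ℝ) 1 →
        c ∈ Set.Ioc (0 : ℝ) 1 → 0 < n →
        μ ≤ f₁ α → ε ≤ f₂ μ → c ≤ f₃ ε → 1 / (n : ℝ) ≤ f₄ c →
        ∀ (V : Type*) [Fintype V] (D : Digraph V),
          Fintype.card V = n →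
          (1 / 2 + α) * (n : ℝ) ≤ (D.minSemidegree : ℝ) →
        ∀ (W : Type*) [Fintype W] (T : Digraph W) (t : W),
          T.IsOrientedTree →
          Fintype.card W = ⌊μ * (n : ℝ)⌋₊ →
          (T.maxOutDegree : ℝ) ≤ c * (n : ℝ) / Real.log (n : ℝ) →
          (T.maxInDegree : ℝ) ≤ c * (n : ℝ) / Real.log (n : ℝ) →
          ∃ A : Finset V, A.card = ⌊(μ - ε) * (n : ℝ)⌋₊ ∧
            ∃ v ∈ A, ∀ B : Finset V, A ⊆ B → B.card = ⌊μ * (n : ℝ)⌋₊ →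
              ∃ φ : T.Copy (D.inducedOn B), (φ.toEmbedding t : V) = v := by
  have hpow : ∀ (k : ℕ) (a : ℝ), 1 ≤ a → IsHierarchyFun fun x => x ^ k / a := fun k a ha =>
    ⟨fun x hx => ⟨div_pos (pow_pos hx.1 k) (by linarith),
      div_le_one_of_le₀ ((pow_le_one₀ hx.1.le hx.2).trans ha) (by linarith)⟩,
      fun x hx y _ hxy => div_le_div_of_nonneg_right (pow_le_pow_left₀ hx.1.le hxy k)
        (by linarith)⟩
  -- There are about μ⁴n/16 guaranteed switchable vertices against about 2εn needed, hence ε ≤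
  -- μ⁴/128. Then c ≤ ε² yields c ≤ μ⁸/16384 for the union bound, and the last function gives c²n ≥
  -- 16.
  refine ⟨fun x => x ^ 1 / 1, fun x => x ^ 4 / 128, fun x => x ^ 2 / 1, fun x => x ^ 2 / 16,
    hpow 1 1 le_rfl, hpow 4 128 (by norm_num), hpow 2 1 le_rfl, hpow 2 16 (by norm_num), ?_⟩
  intro α μ ε c n _ hμ hε hc hn hμα hεμ hcε hnc V _ D hV hD W _ T t hT hW hout hin
  classical
  simp only [pow_one, div_one] at hμα hεμ hcε hnc
  have hn0 : (0 : ℝ) < n := by exact_mod_cast hn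
  have hx : 16 ≤ c ^ 2 * n := by
    rw [div_le_div_iff₀ hn0 (by norm_num)] at hnc
    linarith
  obtain ⟨hcμ, hc1, hεμ', hμ4n, hμn⟩ := hierarchy_bounds hμ.1 hμ.2 hε.1 hεμ hc.1 hcε hx
  set m := ⌊μ * (n : ℝ)⌋₊ with hm
  set N := ⌊(μ - ε) * (n : ℝ)⌋₊ with hN
  have hmle : (m : ℝ) ≤ μ * n := Nat.floor_le (by nlinarith [hμ.1])
  have hNlt : (μ - ε) * n < N + 1 := Nat.lt_floor_add_one _
  have hεn : 0 < ε * n := mul_pos hε.1 hn0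
  have hεn' : ε * n ≤ μ / 128 * n := mul_le_mul_of_nonneg_right hεμ' hn0.le
  have hεn4 : ε * n ≤ μ ^ 4 / 128 * n := mul_le_mul_of_nonneg_right hεμ hn0.le
  have hNm : N ≤ m := Nat.floor_le_floor (by linarith)
  have hNpos : 0 < N := by
    have : (0 : ℝ) < N := by linarith
    exact_mod_cast this
  obtain ⟨e, par, he0, hbij, hpar, hadj, huniq⟩ := hT.isTree.exists_enumeration t
  rw [hW] at hbij hadj huniq
  set dir : ℕ → Bool := fun i => decide (T.Adj (e (par i)) (e i)) with hdir
  obtain ⟨S, hSN, hScard, hS⟩ := exists_independent_numChildren_le_one par hpar N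
  have hScard' : (N : ℝ) ≤ 4 * S.card + 2 := by exact_mod_cast hScard
  have hSn : μ * n / 8 ≤ S.card := by linarith
  obtain ⟨hlog, hlog'⟩ := log_two_mul_sq_lt hμ.1 hμ.2 hc.1 hcμ hc1 hx hSn
  have hchild : ∀ x, (numChildren par N x : ℝ) + 2 ≤ 2 * (c * n / Real.log n) + 2 := by
    intro x
    have h : numChildren par N x ≤ T.maxOutDegree + T.maxInDegree :=
      T.numChildren_le_degree (hbij.injOn.mono (Set.Iio_subset_Iio hNm))
        (fun i h0 hi => (hadj i h0 (by omega)).2) x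
    have h' : (numChildren par N x : ℝ) ≤ T.maxOutDegree + T.maxInDegree := by exact_mod_cast h
    linarith
  have : Nonempty V := Fintype.card_pos_iff.1 (hV ▸ hn)
  have hNle : (N : ℝ) ≤ μ * n := le_trans (by exact_mod_cast hNm) hmle
  have hμαn : μ * n ≤ α * n := mul_le_mul_of_nonneg_right hμα hn0.le
  -- Of 2αn common neighbours at most N ≤ μn ≤ αn are used, leaving at least μn; so β = μ.
  obtain ⟨φ, hφ, hswitch⟩ := D.exists_isPartialCopy_switchable (α := α) (β := μ)
    (L := 2 * (c * n / Real.log n) + 2) (par := par) (N := N)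
    (fun b u => by
      rw [hV]
      exact hD.trans (by exact_mod_cast D.minSemidegree_le_ncard_arc b u))
    hpar dir hSN (fun s hs => ⟨(hS s hs).1, (hS s hs).2.1⟩) hμ.1 hμ.2 (by rw [hV]; linarith)
    (fun x _ => hchild x)
    (by
      have : 0 ≤ c * n / Real.log n := div_nonneg (mul_nonneg hc.1.le hn0.le) hlog.le
      linarith)
    (by rw [hV]; exact hlog')
  have hAcard : ((Finset.range N).image φ).card = N := by
    rw [Finset.card_image_of_injOn, Finset.card_range]
    rw [Finset.coe_range]
    exact hφ.injOn
  refine ⟨(Finset.range N).image φ, hAcard, φ 0,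
    Finset.mem_image_of_mem _ (Finset.mem_range.2 hNpos), fun B hAB hBcard => ?_⟩
  have hgap : (2 * (m - N : ℕ) : ℝ) < μ ^ 3 * S.card / 2 := by
    have h1 : μ ^ 3 * (μ * n / 8) ≤ μ ^ 3 * S.card :=
      mul_le_mul_of_nonneg_left hSn (pow_nonneg hμ.1.le 3)
    have h2 : μ ^ 3 * (μ * n / 8) = μ ^ 4 * n / 8 := by ring
    rw [Nat.cast_sub hNm]
    linarith
  obtain ⟨ψ, hψ, hψB, hψ0⟩ := hφ.exists_extension hpar hSN
    (fun s hs => ⟨(hS s hs).1, (hS s hs).2.2⟩) (B := B)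
    (fun i hi => hAB (Finset.mem_image_of_mem _ (Finset.mem_range.2 hi))) (M := m - N)
    (by omega) hNpos (fun b p v => by exact_mod_cast hgap.trans_le (hswitch b p v))
  rw [Nat.add_sub_cancel' hNm] at hψ hψB
  rw [← hψ0, ← he0]
  exact hψ.exists_copy hT hbij (by omega) (fun i => by simp [hdir]) huniq hψB
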